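/- Let $q$ be an indeterminate and write $[m]_{q}=1+q+\dots+q^{m-1}$ and $[m]_{q}!=[1]_q[2]_q\cdots[m]_q$. Let $n,x\ge 0$ be integers and let $1\le s_1<s_2<\dots<s_n\le n+x$ be integers. On the triangular lattice (with horizontal lattice lines), consider the right trapezoid whose north, northeast, south and west sides have lengths $x$, $2n-1$, $x+n$, $2n-1$; the north, northeast and south sides follow lattice lines and the west side is a vertical zigzag (starting from the west end of the base with a step to the upper right). The base is adjacent to $n+x$ up-pointing unit triangles, numbered $1,\dots,n+x$ from left to right; remove those at the positions $s_1,\dots,s_n$ (for $n=0$ the region is empty). Use coordinates $(i,j)$ in which the $i$-axis runs along the base, one unit of $i$ is half the length of a lattice edge, one unit of $j$ is the height of a unit triangle, and the $j$-axis is the vertical line through the midpoint of the first (westernmost) unit edge of the base; it passes through the centers of the westernmost possible vertical lozenges along the west side. A lozenge is the union of two unit triangles sharing an edge; it is vertical if the shared edge is horizontal. A vertical lozenge with center $(i,j)$ has weight $\frac{q^{i}+q^{-i}}{2}$ if $i\neq 0$ and weight $\frac12$ if $i=0$; all other lozenges have weight $1$. Denote by $R^3_x(s_1,\dots,s_n)$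 the resulting weighted region, and by $\operatorname{M}(R^3_x(s_1,\dots,s_n))$ its tiling generating function, i.e. the sum over all its lozenge tilings of the product of the weights of the lozenges (the empty region has the single empty tiling, of weight $1$). Then, in $\mathbb{Q}(q)$, $$\begin{aligned} \operatorname{M}(R^{3}_{x}(s_1,\dots,s_n)) &=2^{-n(n-1)}\,q^{-\sum_{i=1}^n\left((4i-4)s_i-2i^2-i+3\right)}\, \frac{\prod_{1\le i<j\le n}[2(s_i+s_j-2)]_{q^2}\,[2(s_j-s_i)]_{q^2}}{\prod_{i=1}^{n}[2i-2]_{q^2}!}\\ &=2^{-n(n-1)}\,q^{-\sum_{i=1}^n\left((4i-4)s_i-2i^2-i+3\right)} \prod_{1\le i<j\le n}\frac{[2(s_i+s_j-2)]_{q^2}}{[i+j-1]_{q^2}} \prod_{1\le i<j\le n}\frac{[2(s_j-s_i)]_{q^2}}{[j-i]_{q^2}} . \end{aligned}$$ -/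

import Mathlib

open Finset

noncomputable section

namespace QuarteredHexagon

/-- A unit triangle of the triangular lattice. Coordinates `(i, j)` of the plane: one unit of `i`
is half the length of a lattice edge, one unit of `j` is the height of a unit triangle, the
`i`-axis is a lattice line, and the `j`-axis bisects horizontal lattice edges on the lines of even
height (in particular the origin is the midpoint of a lattice edge), so that the lattice points are
the integer points `(a, b)` with `a + b` odd.
The pair `(i, j)` stands for the unit triangle in the strip between the lines of height `j` and
`j + 1` whose vertical symmetry axis has abscissa `i`:
* for `i + j` even, the up-pointing triangle with vertices `(i-1, j)`, `(i+1, j)`, `(i, j+1)`;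
* for `i + j` odd, the down-pointing triangle with vertices `(i-1, j+1)`, `(i+1, j+1)`, `(i, j)`. -/
abbrev UnitTriangle : Type := ℤ × ℤ

def IsUp (t : UnitTriangle) : Prop := Even (t.1 + t.2)

/-- A candidate lozenge is a pair (up-pointing triangle, down-pointing triangle). -/
abbrev TrianglePair : Type := UnitTriangle × UnitTriangle

/-- The second triangle lies directly below the first one. If the first one, `(i, j)`, is
up-pointing, the two share the horizontal edge from `(i-1, j)` to `(i+1, j)`, and their union is
the vertical lozenge with center `(i, j)`. -/
def IsVertical (l : TrianglePair) : Prop := l.2 = (l.1.1, l.1.2 - 1)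

/-- The up-pointing triangle `l.1` and the down-pointing triangle `l.2` share an edge: the left,
right or bottom edge of `l.1`. -/
def IsLozenge (l : TrianglePair) : Prop :=
  IsUp l.1 ∧ (l.2 = (l.1.1 - 1, l.1.2) ∨ l.2 = (l.1.1 + 1, l.1.2) ∨ IsVertical l)

/-- `T` is a lozenge tiling of the region `R`: a set of lozenges contained in `R` such that every
unit triangle of `R` belongs to exactly one of them. -/
def IsTiling (R : Finset UnitTriangle) (T : Finset TrianglePair) : Prop :=
  (∀ l ∈ T, IsLozenge l ∧ l.1 ∈ R ∧ l.2 ∈ R) ∧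
    ∀ t ∈ R, ∃! l : TrianglePair, l ∈ T ∧ (l.1 = t ∨ l.2 = t)

open Classical in
/-- The finite set of all lozenge tilings of `R`. -/
def tilings (R : Finset UnitTriangle) : Finset (Finset TrianglePair) :=
  (R ×ˢ R).powerset.filter (IsTiling R)

theorem mem_tilings (R : Finset UnitTriangle) (T : Finset TrianglePair) :
    T ∈ tilings R ↔ IsTiling R T := by
  classical
  simp only [tilings, Finset.mem_filter, Finset.mem_powerset, and_iff_right_iff_imp]
  intro h l hl
  exact Finset.mem_product.2 (h.1 l hl).2

/-- The tiling generating function: the sum over all tilings of the product of the weights of the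
lozenges. -/
def tilingGF {K : Type*} [Field K] (wt : TrianglePair → K) (R : Finset UnitTriangle) : K :=
  ∑ T ∈ tilings R, ∏ l ∈ T, wt l

open Classical in
/-- The weight `wt₂`: a vertical lozenge with center `(i, j)` has weight `(q ^ i + q ^ (-i)) / 2`,
but weight `1 / 2` if it is bisected by the `j`-axis (`i = 0`); other lozenges have weight `1`. -/
def wt₂ {K : Type*} [Field K] (q : K) (l : TrianglePair) : K :=
  if IsVertical l then
    if l.1.1 = 0 then 1 / 2 else (q ^ l.1.1 + q ^ (-l.1.1)) / 2
  else 1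

/-- The right trapezoid with sides `x`, `2n-1`, `x+n`, `2n-1` (north, northeast, south, west), empty
for `n = 0`. It consists of the strips `j = 0, …, 2n-2`. The base runs from `(-1, 0)` to
`(2(x+n)-1, 0)`, the northeast side follows the lattice line from `(2(x+n)-1, 0)` to `(2x, 2n-1)`,
and the west side is the vertical zigzag through `(-1, 0), (0, 1), (-1, 2), …, (0, 2n-1)`: the
leftmost unit triangle of each strip has its symmetry axis on the `j`-axis. -/
def trapezoid (n x : ℕ) : Finset UnitTriangle :=
  (Icc (0 : ℤ) (2 * ((x : ℤ) + n) - 2) ×ˢ Icc (0 : ℤ) (2 * (n : ℤ) - 2)).filter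
    fun t => t.1 + t.2 ≤ 2 * ((x : ℤ) + n) - 2

/-- The `p`-th up-pointing unit triangle on the base, counted from the left, starting with `1`. -/
def baseTriangle (p : ℕ) : UnitTriangle := (2 * (p : ℤ) - 2, 0)

/-- The quartered hexagon: the trapezoid with the up-pointing unit triangles at the positions
`s 1, …, s n` of the base removed. -/
def quarteredHexagon (n x : ℕ) (s : ℕ → ℕ) : Finset UnitTriangle :=
  trapezoid n x \ (Icc 1 n).image fun i => baseTriangle (s i)

/-- The tiling generating function of the weighted region `R³_x(s 1, …, s n)`. -/
def tilingGFR3 {K : Type*} [Field K] (q : K) (n x : ℕ) (s : ℕ → ℕ) : K :=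
  tilingGF (wt₂ q) (quarteredHexagon n x s)

/-- The `q`-integer `[m]_q = 1 + q + ⋯ + q ^ (m - 1)`. -/
def qInt {K : Type*} [Field K] (q : K) (m : ℕ) : K := ∑ k ∈ range m, q ^ k

/-- The `q`-factorial `[m]_q! = [1]_q [2]_q ⋯ [m]_q`. -/
def qFactorial {K : Type*} [Field K] (q : K) (m : ℕ) : K := ∏ k ∈ Icc 1 m, qInt q k

end QuarteredHexagon

end

/-!
Cut the trapezoid along the horizontal lattice lines. In the bottom strip the down-pointing
triangles covered by vertical lozenges interlace with the removed up-pointing ones, and all other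
lozenges meeting the strip are then forced. Hence the generating function is a sum, over the
sequences `t` interlacing with the removed triangles, of the weights at the `t k` times the
generating function of the region above the strip with the triangles at the `t k` removed.

By induction on pairs of strips, the generating function is proportional to the Vandermonde
determinant `V` in the variables `q ^ (2 * s i) + q ^ (-(2 * s i))`. Indeed, Weyl's denominator
formulas express `V` (type D) and the products of `V` with `∏ i, (q ^ s i - q ^ (-s i))` (type B)
and `∏ i, (q ^ (2 * s i) - q ^ (-(2 * s i)))` (type C) as determinants whose entries have the form
`q ^ (r * s i) ± q ^ (-(r * s i))`. The weights of the vertical lozenges supply exactly the factors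
that turn each summand into such a determinant; by multilinearity the sum over the interlacing
sequences can be taken entrywise, where it telescopes over the gaps.
-/

noncomputable section

namespace QuarteredHexagon

section Expansion

variable {R : Finset UnitTriangle} {T : Finset TrianglePair} {l l' : TrianglePair} {i j : ℤ}

theorem IsTiling.eq_of_covers (h : IsTiling R T) (hl : l ∈ T) (hl' : l' ∈ T) {t : UnitTriangle}
    (ht : l.1 = t ∨ l.2 = t) (ht' : l'.1 = t ∨ l'.2 = t) : l = l' := by
  have htR : t ∈ R := ht.elim (· ▸ (h.1 l hl).2.1) (· ▸ (h.1 l hl).2.2)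
  exact (h.2 t htR).unique ⟨hl, ht⟩ ⟨hl', ht'⟩

theorem IsTiling.erase (h : IsTiling R T) (hl : l ∈ T) :
    IsTiling (R \ {l.1, l.2}) (T.erase l) := by
  have hdisj : ∀ m ∈ T.erase l, ∀ t, m.1 = t ∨ m.2 = t → t ∉ ({l.1, l.2} : Finset _) := by
    intro m hm t hmt ht
    rw [mem_insert, mem_singleton] at ht
    exact ne_of_mem_erase hm <| h.eq_of_covers (mem_of_mem_erase hm) hl hmt (by tauto)
  refine ⟨fun m hm => ?_, fun t ht => ?_⟩
  · obtain ⟨hloz, h1, h2⟩ := h.1 m (mem_of_mem_erase hm)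
    exact ⟨hloz, mem_sdiff.2 ⟨h1, hdisj m hm _ (.inl rfl)⟩,
      mem_sdiff.2 ⟨h2, hdisj m hm _ (.inr rfl)⟩⟩
  · obtain ⟨htR, htl⟩ := mem_sdiff.1 ht
    obtain ⟨m, ⟨hmT, hmt⟩, huniq⟩ := h.2 t htR
    have hml : m ≠ l := by
      rintro rfl
      exact htl (by rcases hmt with rfl | rfl <;> simp)
    exact ⟨m, ⟨mem_erase.2 ⟨hml, hmT⟩, hmt⟩, fun m' hm' =>
      huniq m' ⟨mem_of_mem_erase hm'.1, hm'.2⟩⟩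

theorem IsTiling.notMem_of_sdiff (h : IsTiling (R \ {l.1, l.2}) T) : l ∉ T := fun hl =>
  (mem_sdiff.1 (h.1 l hl).2.1).2 (mem_insert_self _ _)

theorem IsTiling.insert (h : IsTiling (R \ {l.1, l.2}) T) (hl : IsLozenge l) (h1 : l.1 ∈ R)
    (h2 : l.2 ∈ R) : IsTiling R (insert l T) := by
  have hdisj : ∀ m ∈ T, ∀ t, m.1 = t ∨ m.2 = t → ¬ (l.1 = t ∨ l.2 = t) := by
    rintro m hm t hmt hlt
    obtain ⟨-, hm1, hm2⟩ := h.1 m hm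
    grind
  refine ⟨fun m hm => ?_, fun t ht => ?_⟩
  · rcases mem_insert.1 hm with rfl | hm
    · exact ⟨hl, h1, h2⟩
    · obtain ⟨hloz, hm1, hm2⟩ := h.1 m hm
      exact ⟨hloz, sdiff_subset hm1, sdiff_subset hm2⟩
  · by_cases hlt : l.1 = t ∨ l.2 = t
    · refine ⟨l, ⟨mem_insert_self _ _, hlt⟩, ?_⟩
      rintro m ⟨hm, hmt⟩
      exact (mem_insert.1 hm).resolve_right fun hm => hdisj m hm t hmt hlt
    · have ht' : t ∈ R \ {l.1, l.2} := by
        grind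
      obtain ⟨m, ⟨hm, hmt⟩, huniq⟩ := h.2 t ht'
      refine ⟨m, ⟨mem_insert_of_mem hm, hmt⟩, ?_⟩
      rintro m' ⟨hm', hmt'⟩
      rcases mem_insert.1 hm' with rfl | hm'
      · exact absurd hmt' hlt
      · exact huniq m' ⟨hm', hmt'⟩

open Classical in
/-- The lozenges contained in the region `R` that cover the unit triangle `t`. -/
def lozengesAt (R : Finset UnitTriangle) (t : UnitTriangle) : Finset TrianglePair :=
  (R ×ˢ R).filter fun l => IsLozenge l ∧ (l.1 = t ∨ l.2 = t)

theorem mem_lozengesAt {t : UnitTriangle} :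
    l ∈ lozengesAt R t ↔ (l.1 ∈ R ∧ l.2 ∈ R) ∧ IsLozenge l ∧ (l.1 = t ∨ l.2 = t) := by
  classical rw [lozengesAt, mem_filter, mem_product]

theorem lozengesAt_of_even (hij : Even (i + j)) (hR : (i, j) ∈ R) :
    lozengesAt R (i, j) =
      filter (·.2 ∈ R) {((i, j), (i - 1, j)), ((i, j), (i + 1, j)), ((i, j), (i, j - 1))} := by
  ext ⟨⟨a, b⟩, c, d⟩
  simp only [mem_lozengesAt, mem_filter, mem_insert, mem_singleton, IsLozenge, IsUp, IsVertical,
    Prod.mk.injEq]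
  grind (splits := 20)

theorem lozengesAt_of_odd (hij : Odd (i + j)) (hR : (i, j) ∈ R) :
    lozengesAt R (i, j) =
      filter (·.1 ∈ R) {((i - 1, j), (i, j)), ((i + 1, j), (i, j)), ((i, j + 1), (i, j))} := by
  ext ⟨⟨a, b⟩, c, d⟩
  simp only [mem_lozengesAt, mem_filter, mem_insert, mem_singleton, IsLozenge, IsUp, IsVertical,
    Prod.mk.injEq]
  grind

variable {K : Type*} [Field K] (wt : TrianglePair → K)

theorem tilingGF_empty : tilingGF wt ∅ = 1 := by
  have : tilings ∅ = {∅} := by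
    ext T
    rw [mem_tilings, mem_singleton]
    constructor
    · exact fun h => eq_empty_of_forall_notMem fun l hl => notMem_empty _ (h.1 l hl).2.1
    · rintro rfl
      simp [IsTiling]
  simp [tilingGF, this]

theorem tilingGF_eq_sum_lozengesAt {t : UnitTriangle} (ht : t ∈ R) :
    tilingGF wt R = ∑ l ∈ lozengesAt R t, wt l * tilingGF wt (R \ {l.1, l.2}) := by
  classical
  simp only [tilingGF, mul_sum]
  rw [sum_sigma']
  symm
  refine sum_bij (fun p _ => insert p.1 p.2) ?_ ?_ ?_ ?_ <;>
    simp only [mem_sigma, mem_lozengesAt, mem_tilings]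
  · rintro ⟨l, T⟩ ⟨⟨⟨h1, h2⟩, hl, -⟩, hT⟩
    exact hT.insert hl h1 h2
  · rintro ⟨l, T⟩ ⟨⟨⟨h1, h2⟩, hl, hlt⟩, hT⟩ ⟨l', T'⟩ ⟨⟨-, -, hlt'⟩, hT'⟩ heq
    dsimp only at *
    obtain rfl : l = l' := (hT.insert hl h1 h2).eq_of_covers (mem_insert_self _ _)
      (heq ▸ mem_insert_self _ _) hlt hlt'
    have hTT' : T = T' := by
      rw [← erase_insert hT.notMem_of_sdiff, heq, erase_insert hT'.notMem_of_sdiff]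
    rw [hTT']
  · intro T hT
    obtain ⟨l, ⟨hl, hlt⟩, -⟩ := hT.2 t ht
    obtain ⟨hloz, h12⟩ := hT.1 l hl
    exact ⟨⟨l, T.erase l⟩, ⟨⟨h12, hloz, hlt⟩, hT.erase hl⟩, insert_erase hl⟩
  · rintro ⟨l, T⟩ ⟨-, hT⟩
    rw [prod_insert hT.notMem_of_sdiff]

variable {wt}

theorem tilingGF_of_up_of_only_right (hwt : ∀ l, ¬ IsVertical l → wt l = 1) (hup : Even (i + j))
    (hR : (i, j) ∈ R) (hleft : (i - 1, j) ∉ R) (hright : (i + 1, j) ∈ R)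
    (hbelow : (i, j - 1) ∉ R) :
    tilingGF wt R = tilingGF wt (R \ {(i, j), (i + 1, j)}) := by
  rw [tilingGF_eq_sum_lozengesAt wt hR, lozengesAt_of_even hup hR]
  simp [filter_insert, filter_singleton, hleft, hright, hbelow, hwt, IsVertical]

theorem tilingGF_of_up_of_only_left (hwt : ∀ l, ¬ IsVertical l → wt l = 1) (hup : Even (i + j))
    (hR : (i, j) ∈ R) (hleft : (i - 1, j) ∈ R) (hright : (i + 1, j) ∉ R)
    (hbelow : (i, j - 1) ∉ R) :
    tilingGF wt R = tilingGF wt (R \ {(i - 1, j), (i, j)}) := by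
  rw [tilingGF_eq_sum_lozengesAt wt hR, lozengesAt_of_even hup hR, pair_comm (i - 1, j)]
  simp [filter_insert, filter_singleton, hleft, hright, hbelow, hwt, IsVertical]

theorem tilingGF_of_down_of_not_left (hwt : ∀ l, ¬ IsVertical l → wt l = 1)
    (hdown : Odd (i + j)) (hR : (i, j) ∈ R) (hleft : (i - 1, j) ∉ R) (habove : (i, j + 1) ∈ R) :
    tilingGF wt R =
      wt ((i, j + 1), (i, j)) * tilingGF wt (R \ {(i, j), (i, j + 1)}) +
        if (i + 1, j) ∈ R then tilingGF wt (R \ {(i, j), (i + 1, j)}) else 0 := by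
  rw [tilingGF_eq_sum_lozengesAt wt hR, lozengesAt_of_odd hdown hR]
  have h : wt ((i + 1, j), (i, j)) = 1 := hwt _ (by simp [IsVertical])
  split_ifs with hright <;>
    simp [filter_insert, filter_singleton, hleft, hright, habove, h, pair_comm, add_comm]

end Expansion

section Strip

/-- The unit triangles of the strip `j` whose symmetry axes have abscissas in `[a, b)`. -/
def stripSegment (j a b : ℤ) : Finset UnitTriangle := Ico a b ×ˢ {j}

/-- The integers strictly between `a` and `b` at odd distance from `a`: between two consecutive
removed up-pointing triangles of a strip, the abscissas of the down-pointing triangles. -/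
def gap (a b : ℤ) : Finset ℤ := {t ∈ Ioo a b | Odd (t - a)}

/-- The sequences with one entry in the gap between any two consecutive entries of `s`. -/
def interlacing {m : ℕ} (s : Fin (m + 1) → ℤ) : Finset (Fin m → ℤ) :=
  Fintype.piFinset fun i => gap (s i.castSucc) (s i.succ)

theorem mem_stripSegment {j a b : ℤ} {t : UnitTriangle} :
    t ∈ stripSegment j a b ↔ (a ≤ t.1 ∧ t.1 < b) ∧ t.2 = j := by
  rw [stripSegment, mem_product, mem_Ico, mem_singleton]

theorem mem_gap {a b t : ℤ} : t ∈ gap a b ↔ (a < t ∧ t < b) ∧ Odd (t - a) := by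
  rw [gap, mem_filter, mem_Ioo]

theorem exists_eq_add_two_mul {a b : ℤ} (hab : a ≤ b) (heven : Even (b - a)) :
    ∃ n : ℕ, b = a + 2 * n :=
  ⟨((b - a) / 2).toNat, by grind⟩

theorem gap_self (a : ℤ) : gap a a = ∅ := by simp [gap]

theorem mem_interlacing {m : ℕ} {s : Fin (m + 1) → ℤ} {t : Fin m → ℤ} :
    t ∈ interlacing s ↔ ∀ i, t i ∈ gap (s i.castSucc) (s i.succ) :=
  Fintype.mem_piFinset

theorem stripSegment_eq_pair_union_left {j a b : ℤ} (h : a + 2 ≤ b) :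
    stripSegment j a b = {(a, j), (a + 1, j)} ∪ stripSegment j (a + 2) b := by
  ext ⟨i, k⟩
  simp only [mem_union, mem_insert, mem_singleton, mem_stripSegment, Prod.mk.injEq]
  omega

theorem stripSegment_eq_pair_union_right {j a b : ℤ} (h : a + 2 ≤ b) :
    stripSegment j a b = {(b - 2, j), (b - 1, j)} ∪ stripSegment j a (b - 2) := by
  ext ⟨i, k⟩
  simp only [mem_union, mem_insert, mem_singleton, mem_stripSegment, Prod.mk.injEq]
  omega

theorem sum_gap_eq_add {M : Type*} [AddCommMonoid M] {a b : ℤ} (h : a + 1 < b) (f : ℤ → M) :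
    ∑ t ∈ gap a b, f t = f (a + 1) + ∑ t ∈ gap (a + 2) b, f t := by
  have hgap : gap a b = insert (a + 1) (gap (a + 2) b) := by
    ext t
    simp only [mem_insert, mem_gap]
    grind
  rw [hgap, sum_insert (by simp [mem_gap])]

theorem sum_interlacing_succ {M : Type*} [AddCommMonoid M] {m : ℕ} (s : Fin (m + 2) → ℤ)
    (f : (Fin (m + 1) → ℤ) → M) :
    ∑ t ∈ interlacing s, f t =
      ∑ c ∈ gap (s 0) (s 1), ∑ t ∈ interlacing (Fin.tail s), f (Fin.cons c t) := by
  rw [← sum_product']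
  refine sum_equiv (Fin.consEquiv fun _ => ℤ).symm (fun t => ?_) (fun t _ => ?_)
  · simp only [interlacing, Fin.mem_piFinset_iff_zero_tail, mem_product]
    rfl
  · exact congrArg f (Fin.cons_self_tail t).symm

variable {K : Type*} [Field K] {wt : TrianglePair → K} {R : Finset UnitTriangle} {j : ℤ}

theorem tilingGF_sdiff_stripSegment_of_left (hwt : ∀ l, ¬ IsVertical l → wt l = 1)
    (hlow : ∀ t ∈ R, j ≤ t.2) {a : ℤ} (ha : Even (a + j)) (n : ℕ) (hleft : (a - 1, j) ∉ R)
    (hR : stripSegment j a (a + 2 * n) ⊆ R) :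
    tilingGF wt R = tilingGF wt (R \ stripSegment j a (a + 2 * n)) := by
  induction n generalizing a R with
  | zero => simp [stripSegment]
  | succ n ih =>
    have hend : a + 2 * ((n + 1 : ℕ) : ℤ) = a + 2 + 2 * n := by push_cast; ring
    rw [hend] at hR ⊢
    have hmem : ∀ i, a ≤ i → i < a + 2 + 2 * n → (i, j) ∈ R := fun i h1 h2 =>
      hR (mem_stripSegment.2 ⟨⟨h1, h2⟩, rfl⟩)
    rw [tilingGF_of_up_of_only_right hwt ha (hmem _ (by lia) (by lia)) hleft
      (hmem _ (by lia) (by lia)) fun h => by simpa using hlow _ h,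
      stripSegment_eq_pair_union_left (by lia), ← sup_eq_union, ← sdiff_sdiff_left]
    refine ih (fun t ht => hlow t (sdiff_subset ht)) (by grind) (by grind) fun t ht => ?_
    grind [mem_stripSegment]

theorem tilingGF_sdiff_stripSegment_of_right (hwt : ∀ l, ¬ IsVertical l → wt l = 1)
    (hlow : ∀ t ∈ R, j ≤ t.2) {b : ℤ} (hb : Odd (b + j)) (n : ℕ) (hright : (b, j) ∉ R)
    (hR : stripSegment j (b - 2 * n) b ⊆ R) :
    tilingGF wt R = tilingGF wt (R \ stripSegment j (b - 2 * n) b) := by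
  induction n generalizing b R with
  | zero => simp [stripSegment]
  | succ n ih =>
    have hend : b - 2 * ((n + 1 : ℕ) : ℤ) = b - 2 - 2 * n := by push_cast; ring
    rw [hend] at hR ⊢
    have hmem : ∀ i, b - 2 - 2 * n ≤ i → i < b → (i, j) ∈ R := fun i h1 h2 =>
      hR (mem_stripSegment.2 ⟨⟨h1, h2⟩, rfl⟩)
    rw [tilingGF_of_up_of_only_left hwt (i := b - 1) (by grind) (hmem _ (by lia) (by lia))
      (hmem _ (by lia) (by lia)) (by simpa) fun h => by simpa using hlow _ h,
      stripSegment_eq_pair_union_right (by lia), ← sup_eq_union, ← sdiff_sdiff_left,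
      show b - 1 - 1 = b - 2 by ring]
    refine ih (fun t ht => hlow t (sdiff_subset ht)) (by grind) (by grind) fun t ht => ?_
    grind [mem_stripSegment]

theorem tilingGF_eq_vertical_add (hwt : ∀ l, ¬ IsVertical l → wt l = 1)
    (hlow : ∀ t ∈ R, j ≤ t.2) {c : ℤ} (hc : Even (c + j)) (n : ℕ) (hleft : (c, j) ∉ R)
    (hR : stripSegment j (c + 1) (c + 2 * n + 2) ⊆ R) (habove : (c + 1, j + 1) ∈ R) :
    tilingGF wt R = wt ((c + 1, j + 1), (c + 1, j)) *
        tilingGF wt ((R \ stripSegment j (c + 1) (c + 2 * n + 2)) \ {(c + 1, j + 1)}) +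
      if (c + 2, j) ∈ R then tilingGF wt (R \ {(c + 1, j), (c + 2, j)}) else 0 := by
  have hforced : tilingGF wt (R \ {(c + 1, j), (c + 1, j + 1)}) =
      tilingGF wt ((R \ stripSegment j (c + 1) (c + 2 * n + 2)) \ {(c + 1, j + 1)}) := by
    rw [tilingGF_sdiff_stripSegment_of_left hwt (fun t ht => hlow t (sdiff_subset ht))
      (a := c + 2) (by grind) n (by grind) (fun t ht => by grind [mem_stripSegment])]
    congr 1
    grind [mem_stripSegment]
  rw [tilingGF_of_down_of_not_left hwt (i := c + 1) (by grind) (hR (by grind [mem_stripSegment]))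
    (by simpa) habove, hforced, show c + 1 + 1 = c + 2 by ring]

theorem tilingGF_eq_sum_gap (hwt : ∀ l, ¬ IsVertical l → wt l = 1)
    (hlow : ∀ t ∈ R, j ≤ t.2) {c : ℤ} (hc : Even (c + j)) (n : ℕ) (hleft : (c, j) ∉ R)
    (hright : (c + 2 * n + 2, j) ∉ R) (hR : stripSegment j (c + 1) (c + 2 * n + 2) ⊆ R)
    (habove : ∀ t ∈ gap c (c + 2 * n + 2), (t, j + 1) ∈ R) :
    tilingGF wt R = ∑ t ∈ gap c (c + 2 * n + 2), wt ((t, j + 1), (t, j)) *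
      tilingGF wt ((R \ stripSegment j (c + 1) (c + 2 * n + 2)) \ {(t, j + 1)}) := by
  induction n generalizing c R with
  | zero =>
    rw [tilingGF_eq_vertical_add hwt hlow hc 0 hleft hR (habove _ (by grind [mem_gap])),
      sum_gap_eq_add (by lia)]
    simp_all [gap_self]
  | succ n ih =>
    have hend : c + 2 * ((n + 1 : ℕ) : ℤ) + 2 = c + 2 + 2 * n + 2 := by push_cast; ring
    have hrest : (R \ {(c + 1, j), (c + 2, j)}) \ stripSegment j (c + 2 + 1) (c + 2 + 2 * n + 2) =
        R \ stripSegment j (c + 1) (c + 2 + 2 * n + 2) := by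
      rw [stripSegment_eq_pair_union_left (a := c + 1) (by lia), ← sup_eq_union,
        ← sdiff_sdiff_left, show c + 1 + 1 = c + 2 by ring, show c + 1 + 2 = c + 2 + 1 by ring]
    rw [tilingGF_eq_vertical_add hwt hlow hc (n + 1) hleft hR (habove _ (by grind [mem_gap])),
      sum_gap_eq_add (by lia), if_pos (hR (by grind [mem_stripSegment]))]
    rw [hend] at hright hR habove ⊢
    rw [ih (c := c + 2) (fun t ht => hlow t (sdiff_subset ht)) (by grind) (by grind) (by grind)
      (fun t ht => by grind [mem_stripSegment]) (fun t ht => by grind [mem_gap]), hrest]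

theorem tilingGF_eq_sum_first_gap (hwt : ∀ l, ¬ IsVertical l → wt l = 1)
    (hlow : ∀ t ∈ R, j ≤ t.2) {m : ℕ} {s : Fin (m + 2) → ℤ} (hs : StrictMono s)
    (heven : ∀ k, Even (s k + j))
    (hrow : ∀ i, (i, j) ∈ R ↔ (s 0 < i ∧ i < s (Fin.last (m + 1))) ∧ i ∉ Set.range s)
    (habove : ∀ i, s 0 < i → i < s (Fin.last (m + 1)) → Odd (i + j) → (i, j + 1) ∈ R) :
    tilingGF wt R = ∑ t ∈ gap (s 0) (s 1), wt ((t, j + 1), (t, j)) *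
      tilingGF wt ((R \ stripSegment j (s 0 + 1) (s 1)) \ {(t, j + 1)}) := by
  have h01 : s 0 < s 1 := hs Fin.zero_lt_one
  have h1last : s 1 ≤ s (Fin.last (m + 1)) := hs.monotone (Fin.le_last _)
  obtain ⟨n, hn⟩ : ∃ n : ℕ, s 1 = s 0 + 2 * n + 2 := by
    obtain ⟨n, hn⟩ := exists_eq_add_two_mul (a := s 0 + 2) (b := s 1) (by grind) (by grind)
    exact ⟨n, by lia⟩
  have hstrip : stripSegment j (s 0 + 1) (s 1) ⊆ R := by
    rintro ⟨i, k⟩ hi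
    obtain ⟨⟨h0, h1⟩, rfl⟩ := mem_stripSegment.1 hi
    refine (hrow i).2 ⟨⟨by lia, by lia⟩, ?_⟩
    rintro ⟨k, rfl⟩
    have hk0 : 0 < k := hs.lt_iff_lt.1 (Int.add_one_le_iff.1 h0)
    exact h1.not_ge (hs.monotone (Fin.one_le_of_ne_zero hk0.ne'))
  rw [tilingGF_eq_sum_gap hwt hlow (heven 0) n (by simp [hrow]) (by simp [hrow, ← hn])
    (hn ▸ hstrip) (fun t ht => by grind [mem_gap]), ← hn]

theorem tilingGF_eq_sum_interlacing_of_row (hwt : ∀ l, ¬ IsVertical l → wt l = 1)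
    (hlow : ∀ t ∈ R, j ≤ t.2) {m : ℕ} {s : Fin (m + 1) → ℤ} (hs : StrictMono s)
    (heven : ∀ k, Even (s k + j))
    (hrow : ∀ i, (i, j) ∈ R ↔ (s 0 < i ∧ i < s (Fin.last m)) ∧ i ∉ Set.range s)
    (habove : ∀ i, s 0 < i → i < s (Fin.last m) → Odd (i + j) → (i, j + 1) ∈ R) :
    tilingGF wt R = ∑ t ∈ interlacing s, (∏ k, wt ((t k, j + 1), (t k, j))) *
      tilingGF wt ({u ∈ R | j < u.2} \ univ.image fun k => (t k, j + 1)) := by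
  induction m generalizing R with
  | zero =>
    have hfilter : {u ∈ R | j < u.2} = R := by
      refine filter_true_of_mem fun u hu => (hlow u hu).lt_of_ne fun hj => ?_
      subst hj
      have := ((hrow u.1).1 hu).1
      exact lt_asymm this.1 this.2
    simp [interlacing, hfilter]
  | succ m ih =>
    have hmem_range (i : ℤ) : i ∈ Set.range s ↔ i = s 0 ∨ i ∈ Set.range (Fin.tail s) := by
      simp [Set.mem_range, Fin.exists_fin_succ, Fin.tail, eq_comm]
    rw [tilingGF_eq_sum_first_gap hwt hlow hs heven hrow habove, sum_interlacing_succ]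
    refine sum_congr rfl fun c hc => ?_
    obtain ⟨⟨h0c, hc1⟩, -⟩ := mem_gap.1 hc
    rw [ih (s := Fin.tail s) (fun u hu => hlow u (sdiff_subset (sdiff_subset hu)))
      (fun a b h => hs (Fin.succ_lt_succ_iff.2 h)) (fun k => heven _)
      (fun i => ?_) (fun i h1 h2 h3 => ?_), mul_sum]
    · refine sum_congr rfl fun t _ => ?_
      rw [Fin.prod_univ_succ]
      simp only [Fin.cons_zero, Fin.cons_succ, mul_assoc]
      congr 3
      ext u
      simp only [mem_sdiff, mem_filter, mem_image, mem_univ, true_and, Fin.exists_fin_succ,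
        Fin.cons_zero, Fin.cons_succ, mem_stripSegment, mem_singleton]
      grind
    · simp only [mem_sdiff, hrow, hmem_range, mem_stripSegment, mem_singleton]
      have htail0 : Fin.tail s 0 = s 1 := rfl
      have htail_last : Fin.tail s (Fin.last m) = s (Fin.last (m + 1)) := rfl
      grind
    · have h1 : s 1 < i := h1
      simp only [mem_sdiff, mem_stripSegment, mem_singleton, Prod.mk.injEq]
      exact ⟨⟨habove i (by lia) h2 h3, by lia⟩, by lia⟩

theorem tilingGF_eq_sum_interlacing (hwt : ∀ l, ¬ IsVertical l → wt l = 1)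
    (hlow : ∀ t ∈ R, j ≤ t.2) {m : ℕ} {s : Fin (m + 1) → ℤ} (hs : StrictMono s)
    (heven : ∀ k, Even (s k + j)) {a b : ℤ} (ha : Even (a + j)) (hb : Even (b + j))
    (has : a ≤ s 0) (hsb : s (Fin.last m) ≤ b)
    (hrow : ∀ i, (i, j) ∈ R ↔ (a ≤ i ∧ i ≤ b) ∧ i ∉ Set.range s)
    (habove : ∀ i, s 0 < i → i < s (Fin.last m) → Odd (i + j) → (i, j + 1) ∈ R) :
    tilingGF wt R = ∑ t ∈ interlacing s, (∏ k, wt ((t k, j + 1), (t k, j))) *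
      tilingGF wt ({u ∈ R | j < u.2} \ univ.image fun k => (t k, j + 1)) := by
  obtain ⟨p, hp⟩ := exists_eq_add_two_mul has (by grind)
  obtain ⟨r, hr⟩ := exists_eq_add_two_mul hsb (by grind)
  replace hr : s (Fin.last m) + 1 = b + 1 - 2 * r := by lia
  have hs0 (k) : s 0 ≤ s k := hs.monotone (Fin.zero_le k)
  have hslast (k) : s k ≤ s (Fin.last m) := hs.monotone (Fin.le_last k)
  have hleft : stripSegment j a (s 0) ⊆ R := by
    rintro ⟨i, k⟩ hi
    obtain ⟨⟨h0, h1⟩, rfl⟩ := mem_stripSegment.1 hi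
    grind
  have hright : stripSegment j (s (Fin.last m) + 1) (b + 1) ⊆ R \ stripSegment j a (s 0) := by
    rintro ⟨i, k⟩ hi
    obtain ⟨⟨h0, h1⟩, rfl⟩ := mem_stripSegment.1 hi
    grind [mem_stripSegment]
  rw [tilingGF_sdiff_stripSegment_of_left hwt hlow ha p (by grind) (hp ▸ hleft), ← hp,
    tilingGF_sdiff_stripSegment_of_right hwt (fun t ht => hlow t (sdiff_subset ht))
      (b := b + 1) (by grind) r (by grind) (hr ▸ hright), ← hr,
    tilingGF_eq_sum_interlacing_of_row hwt
      (fun t ht => hlow t (sdiff_subset (sdiff_subset ht))) hs heven (fun i => ?_)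
      fun i h0 h1 h2 => ?_]
  · refine sum_congr rfl fun t _ => ?_
    congr 3
    ext u
    simp only [mem_filter, mem_sdiff, mem_stripSegment]
    grind
  · simp only [mem_sdiff, hrow, mem_stripSegment]
    grind
  · simp only [mem_sdiff, mem_stripSegment]
    grind

end Strip

section Determinants

open Polynomial

variable {A : Type*} [CommRing A]

theorem exists_monic_eval_of_three_term [Nontrivial A] {ι : Type*} {f : ℕ → ι → A} {y : ι → A}
    (h1 : ∃ b, ∀ i, f 1 i = (y i + b) * f 0 i)
    (h2 : ∀ k, ∃ b c, ∀ i, f (k + 2) i = (y i + b) * f (k + 1) i - c * f k i) (k : ℕ) :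
    ∃ p : A[X], p.Monic ∧ p.natDegree = k ∧ ∀ i, f k i = f 0 i * p.eval (y i) := by
  induction k using Nat.twoStepInduction with
  | zero => exact ⟨1, monic_one, natDegree_one, by simp⟩
  | one =>
    obtain ⟨b, hb⟩ := h1
    exact ⟨X + C b, monic_X_add_C b, natDegree_X_add_C b, fun i => by simp [hb, mul_comm]⟩
  | more k ih ih' =>
    obtain ⟨p, -, hpdeg, hp⟩ := ih
    obtain ⟨p', hp'monic, hp'deg, hp'⟩ := ih'
    obtain ⟨b, c, hbc⟩ := h2 k
    have hmonic : ((X + C b) * p').Monic := (monic_X_add_C b).mul hp'monic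
    have hdeg : ((X + C b) * p').natDegree = k + 2 := by
      rw [(monic_X_add_C b).natDegree_mul hp'monic, natDegree_X_add_C, hp'deg]
      ring
    have hlt : (C c * p).natDegree < ((X + C b) * p').natDegree := by
      have := natDegree_C_mul_le c p
      lia
    refine ⟨(X + C b) * p' - C c * p, hmonic.sub_of_left (degree_lt_degree hlt), ?_, fun i => ?_⟩
    · rw [natDegree_sub_eq_left_of_natDegree_lt hlt, hdeg]
    · simp only [hbc, hp, hp', eval_sub, eval_mul, eval_add, eval_X, eval_C]
      ring

theorem det_eq_prod_mul_det_vandermonde_of_three_term [Nontrivial A] {m : ℕ}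
    {f : ℕ → Fin m → A} {y : Fin m → A} (h1 : ∃ b, ∀ i, f 1 i = (y i + b) * f 0 i)
    (h2 : ∀ k, ∃ b c, ∀ i, f (k + 2) i = (y i + b) * f (k + 1) i - c * f k i) :
    (Matrix.of fun i k : Fin m => f k i).det = (∏ i, f 0 i) * (Matrix.vandermonde y).det := by
  choose p hmonic hdeg hp using exists_monic_eval_of_three_term h1 h2
  rw [Matrix.det_eval_matrixOfPolynomials_eq_det_vandermonde y (fun k => p k)
    (fun k => hdeg k) fun k => hmonic k, ← Matrix.det_mul_column]
  exact congrArg Matrix.det (Matrix.ext fun i k => hp k i)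

theorem sum_piFinset_det {α : Type*} {m : ℕ} (I : Fin m → Finset α)
    (g : Fin m → α → A) :
    ∑ t ∈ Fintype.piFinset I, (Matrix.of fun i k => g k (t i)).det =
      (Matrix.of fun i k => ∑ t ∈ I i, g k t).det := by
  classical
  refine ((Matrix.detRowAlternating (n := Fin m) (R := A)).toMultilinearMap.map_sum_finset
    (fun _ t k => g k t) I).symm.trans (congrArg Matrix.det ?_)
  ext i k
  exact sum_apply k (I i) _

theorem det_sub_castSucc_eq_det_cons_one {m : ℕ} (G : Fin m → Fin (m + 1) → A) :
    (Matrix.of fun i k : Fin m => G k i.succ - G k i.castSucc).det =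
      (Matrix.of fun i : Fin (m + 1) => (Fin.cons 1 fun k => G k i : Fin (m + 1) → A)).det := by
  have hrows := Matrix.det_eq_of_forall_row_eq_smul_add_pred
    (A := Matrix.of fun i : Fin (m + 1) => (Fin.cons 1 fun k => G k i : Fin (m + 1) → A))
    (B := Matrix.of (Fin.cons (Fin.cons 1 fun k => G k 0)
      fun i => Fin.cons 0 fun k => G k i.succ - G k i.castSucc)) (fun _ => 1) (fun k => by simp)
    fun i k => by refine Fin.cases ?_ (fun k => ?_) k <;> simp
  rw [hrows, Matrix.det_succ_column_zero, Fin.sum_univ_succ]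
  simp [Matrix.submatrix]

theorem sum_gap_sub {M : Type*} [AddCommGroup M] {a b : ℤ} (hab : a ≤ b) (heven : Even (b - a))
    (G : ℤ → M) : ∑ t ∈ gap a b, (G (t + 1) - G (t - 1)) = G b - G a := by
  obtain ⟨n, rfl⟩ := exists_eq_add_two_mul hab heven
  clear hab heven
  induction n generalizing a with
  | zero => simp [gap_self]
  | succ n ih =>
    have hend : a + 2 * ((n + 1 : ℕ) : ℤ) = a + 2 + 2 * n := by push_cast; ring
    rw [sum_gap_eq_add (by lia), hend, ih, show a + 1 + 1 = a + 2 by ring, add_sub_cancel_right]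
    abel

theorem sum_interlacing_det {m : ℕ} {s : Fin (m + 1) → ℤ} (hs : Monotone s)
    (heven : ∀ i : Fin m, Even (s i.succ - s i.castSucc)) {g G : ℕ → ℤ → A}
    (hG : ∀ k (i : Fin m), ∀ t ∈ gap (s i.castSucc) (s i.succ), g k t = G k (t + 1) - G k (t - 1)) :
    ∑ t ∈ interlacing s, (Matrix.of fun i k : Fin m => g k (t i)).det =
      (Matrix.of fun i : Fin (m + 1) =>
        (Fin.cons 1 fun k : Fin m => G k (s i) : Fin (m + 1) → A)).det := by
  rw [interlacing, sum_piFinset_det _ fun k : Fin m => g k,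
    ← det_sub_castSucc_eq_det_cons_one fun (k : Fin m) i => G k (s i)]
  congr 1
  ext i k
  rw [Matrix.of_apply, Matrix.of_apply, sum_congr rfl (hG k i),
    sum_gap_sub (hs i.castSucc_le_succ) (heven i)]

theorem det_cons_one_mul {m : ℕ} (c : Fin m → A) (G : Fin m → Fin (m + 1) → A) :
    (Matrix.of fun i : Fin (m + 1) => (Fin.cons 1 fun k => c k * G k i : Fin (m + 1) → A)).det =
      (∏ k, c k) *
        (Matrix.of fun i : Fin (m + 1) => (Fin.cons 1 fun k => G k i : Fin (m + 1) → A)).det := by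
  have hcons : ∏ k, (Fin.cons 1 c : Fin (m + 1) → A) k = ∏ k, c k := by simp [Fin.prod_univ_succ]
  rw [← hcons, ← Matrix.det_mul_row]
  congr 1
  ext i k
  refine Fin.cases ?_ (fun k => ?_) k <;> simp

theorem det_cons_one_of_zero {m : ℕ} (G : Fin m → Fin (m + 1) → A) (hG : ∀ k, G k 0 = 0) :
    (Matrix.of fun i : Fin (m + 1) => (Fin.cons 1 fun k => G k i : Fin (m + 1) → A)).det =
      (Matrix.of fun i k : Fin m => G k i.succ).det := by
  rw [Matrix.det_succ_row_zero, Fin.sum_univ_succ]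
  simp [hG, Matrix.submatrix]

end Determinants

section WeylDenominators

variable {K : Type*} [Field K] {q : K}

/-- Twice the hyperbolic sine of `r log q`. -/
def qSinh (q : K) (r : ℤ) : K := q ^ r - q ^ (-r)

/-- Twice the hyperbolic cosine of `r log q`. -/
def qCosh (q : K) (r : ℤ) : K := q ^ r + q ^ (-r)

/-- The weight of a vertical lozenge as a function of the abscissa `i` of its center. -/
def vertWeight (q : K) (i : ℤ) : K := if i = 0 then 1 / 2 else qCosh q i / 2

theorem qSinh_neg (q : K) (r : ℤ) : qSinh q (-r) = -qSinh q r := by simp [qSinh]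

theorem qSinh_zero (q : K) : qSinh q 0 = 0 := by simp [qSinh]

theorem qCosh_neg (q : K) (r : ℤ) : qCosh q (-r) = qCosh q r := by simp [qCosh, add_comm]

theorem qCosh_zero (q : K) : qCosh q 0 = 2 := by norm_num [qCosh]

theorem qSinh_ne_zero (hq : q ≠ 0) (hfin : ¬ IsOfFinOrder q) {r : ℤ} (hr : r ≠ 0) :
    qSinh q r ≠ 0 := by
  intro h
  have hpow : (Units.mk0 q hq) ^ (2 * r) = 1 := by
    ext
    rw [qSinh, sub_eq_zero, zpow_neg, ← mul_eq_one_iff_eq_inv₀ (zpow_ne_zero r hq)] at h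
    rw [Units.val_zpow_eq_zpow_val, Units.val_mk0, two_mul, zpow_add₀ hq, h, Units.val_one]
  have := isOfFinOrder_iff_zpow_eq_one.2 ⟨2 * r, by simpa, hpow⟩
  exact hfin (Units.isOfFinOrder_val.2 this)

theorem qSinh_add_add_qSinh_sub (hq : q ≠ 0) (a b : ℤ) :
    qSinh q (a + b) + qSinh q (a - b) = qSinh q a * qCosh q b := by
  simp only [qSinh, qCosh, zpow_neg, zpow_add₀ hq, zpow_sub₀ hq]
  field_simp
  ring

theorem qSinh_add_sub_qSinh_sub (hq : q ≠ 0) (a b : ℤ) :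
    qSinh q (a + b) - qSinh q (a - b) = qCosh q a * qSinh q b := by
  simp only [qSinh, qCosh, zpow_neg, zpow_add₀ hq, zpow_sub₀ hq]
  field_simp
  ring

theorem qCosh_add_add_qCosh_sub (hq : q ≠ 0) (a b : ℤ) :
    qCosh q (a + b) + qCosh q (a - b) = qCosh q a * qCosh q b := by
  simp only [qCosh, zpow_neg, zpow_add₀ hq, zpow_sub₀ hq]
  field_simp
  ring

theorem qCosh_add_sub_qCosh_sub (hq : q ≠ 0) (a b : ℤ) :
    qCosh q (a + b) - qCosh q (a - b) = qSinh q a * qSinh q b := by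
  simp only [qSinh, qCosh, zpow_neg, zpow_add₀ hq, zpow_sub₀ hq]
  field_simp
  ring

theorem vertWeight_mul_qSinh (hq : q ≠ 0) (t : ℤ) :
    vertWeight q t * qSinh q t = qSinh q (2 * t) / 2 := by
  rcases eq_or_ne t 0 with rfl | ht
  · simp [qSinh_zero]
  · have h := qSinh_add_sub_qSinh_sub hq t t
    rw [sub_self, qSinh_zero, sub_zero, ← two_mul] at h
    rw [vertWeight, if_neg ht, h]
    ring

variable {m : ℕ}

theorem prod_qSinh_mul_det_vandermonde (hq : q ≠ 0) (s : Fin m → ℤ) :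
    (∏ i, qSinh q (s i)) * (Matrix.vandermonde fun i => qCosh q (2 * s i)).det =
      (Matrix.of fun i k : Fin m => qSinh q ((2 * k + 1) * s i)).det := by
  rw [det_eq_prod_mul_det_vandermonde_of_three_term
    (f := fun k i => qSinh q ((2 * k + 1) * s i)) (y := fun i => qCosh q (2 * s i))
    ⟨1, fun i => ?_⟩ fun k => ⟨0, 1, fun i => ?_⟩]
  · simp
  · have h := qSinh_add_add_qSinh_sub hq (s i) (2 * s i)
    rw [show s i - 2 * s i = -s i by ring, qSinh_neg] at h
    push_cast
    ring_nf at h ⊢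
    linear_combination h
  · have h := qSinh_add_add_qSinh_sub hq ((2 * k + 3) * s i) (2 * s i)
    push_cast
    ring_nf at h ⊢
    linear_combination h

theorem prod_vertWeight_mul_det_vandermonde (hq : q ≠ 0) (t : Fin m → ℤ) :
    (∏ i, vertWeight q (t i)) * (Matrix.vandermonde fun i => qCosh q (2 * t i)).det =
      (Matrix.of fun i k : Fin m => vertWeight q ((2 * k + 1) * t i)).det := by
  have hodd (k : ℕ) : (2 * k + 1 : ℤ) ≠ 0 := by lia
  rw [det_eq_prod_mul_det_vandermonde_of_three_term
    (f := fun k i => vertWeight q ((2 * k + 1) * t i)) (y := fun i => qCosh q (2 * t i))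
    ⟨-1, fun i => ?_⟩ fun k => ⟨0, 1, fun i => ?_⟩]
  · simp
  · rcases eq_or_ne (t i) 0 with ht | ht
    · simp only [ht, mul_zero, vertWeight, if_true, qCosh_zero]
      ring
    · have h := qCosh_add_add_qCosh_sub hq (t i) (2 * t i)
      rw [show t i - 2 * t i = -t i by ring, qCosh_neg] at h
      simp only [vertWeight, mul_eq_zero, hodd, ht, or_self, if_false]
      push_cast
      ring_nf at h ⊢
      linear_combination h / 2
  · rcases eq_or_ne (t i) 0 with ht | ht
    · simp only [ht, mul_zero, vertWeight, if_true, qCosh_zero]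
      ring
    · have h := qCosh_add_add_qCosh_sub hq ((2 * k + 3) * t i) (2 * t i)
      simp only [vertWeight, mul_eq_zero, hodd, ht, or_self, if_false]
      push_cast
      ring_nf at h ⊢
      linear_combination h / 2

-- `vertWeight q t * qSinh q t = qSinh q (2 * t) / 2` makes this the type C denominator formula.
theorem prod_vertWeight_mul_qSinh_mul_det_vandermonde (hq : q ≠ 0) (t : Fin m → ℤ) :
    (∏ i, vertWeight q (t i)) *
        ((∏ i, qSinh q (t i)) * (Matrix.vandermonde fun i => qCosh q (2 * t i)).det) =
      (Matrix.of fun i k : Fin m => qSinh q ((2 * k + 2) * t i) / 2).det := by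
  rw [← mul_assoc, ← prod_mul_distrib, det_eq_prod_mul_det_vandermonde_of_three_term
    (f := fun k i => qSinh q ((2 * k + 2) * t i) / 2) (y := fun i => qCosh q (2 * t i))
    ⟨0, fun i => ?_⟩ fun k => ⟨0, 1, fun i => ?_⟩]
  · simp [vertWeight_mul_qSinh hq]
  · have h := qSinh_add_add_qSinh_sub hq (2 * t i) (2 * t i)
    rw [sub_self, qSinh_zero] at h
    push_cast
    ring_nf at h ⊢
    linear_combination h / 2
  · have h := qSinh_add_add_qSinh_sub hq ((2 * k + 4) * t i) (2 * t i)
    push_cast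
    ring_nf at h ⊢
    linear_combination h / 2

theorem det_vandermonde_qCosh (hq : q ≠ 0) (s : Fin (m + 1) → ℤ) :
    (Matrix.vandermonde fun i => qCosh q (2 * s i)).det =
      (Matrix.of fun i : Fin (m + 1) =>
        (Fin.cons 1 fun k : Fin m => qCosh q ((2 * k + 2) * s i) : Fin (m + 1) → K)).det := by
  have h := det_eq_prod_mul_det_vandermonde_of_three_term
    (f := fun k i => if k = 0 then 1 else qCosh q (2 * k * s i))
    (y := fun i => qCosh q (2 * s i)) ⟨0, fun i => ?_⟩
    fun k => ⟨0, if k = 0 then 2 else 1, fun i => ?_⟩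
  · simp only [if_true, prod_const_one, one_mul] at h
    rw [← h]
    congr 1
    ext i k
    refine Fin.cases ?_ (fun k => ?_) k
    · rfl
    · simp [mul_add]
  · simp
  · have h := qCosh_add_add_qCosh_sub hq (2 * (k + 1) * s i) (2 * s i)
    rcases eq_or_ne k 0 with rfl | hk
    · simp only [CharP.cast_eq_zero, zero_add, mul_one, sub_self, qCosh_zero,
        OfNat.ofNat_ne_zero, if_true, if_false, Nat.cast_ofNat, add_zero, one_ne_zero,
        Nat.cast_one] at h ⊢
      ring_nf at h ⊢
      linear_combination h
    · simp only [hk, Nat.add_eq_zero_iff, OfNat.ofNat_ne_zero, one_ne_zero, and_self,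
        if_false]
      push_cast
      ring_nf at h ⊢
      linear_combination h

theorem sum_interlacing_even_strip (hq : q ≠ 0) (hfin : ¬ IsOfFinOrder q)
    {s : Fin (m + 1) → ℤ} (hs : Monotone s) (heven : ∀ i, Even (s i)) :
    ∑ t ∈ interlacing s, (∏ i, vertWeight q (t i)) *
        ((∏ i, qSinh q (t i)) * (Matrix.vandermonde fun i => qCosh q (2 * t i)).det) =
      (∏ k : Fin m, (2 * qSinh q (2 * k + 2))⁻¹) *
        (Matrix.vandermonde fun i => qCosh q (2 * s i)).det := by
  simp only [prod_vertWeight_mul_qSinh_mul_det_vandermonde hq]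
  rw [sum_interlacing_det hs (fun i => (heven _).sub (heven _))
    (g := fun k t => qSinh q ((2 * k + 2) * t) / 2)
    (G := fun k t => (2 * qSinh q (2 * k + 2))⁻¹ * qCosh q ((2 * k + 2) * t)) fun k i t _ => ?_,
    det_vandermonde_qCosh hq, ← det_cons_one_mul]
  have hk : qSinh q (2 * k + 2) ≠ 0 := qSinh_ne_zero hq hfin (by lia)
  rw [← mul_sub, mul_add, mul_sub _ t, mul_one, qCosh_add_sub_qCosh_sub hq]
  field_simp

-- Cutting the primitive off below `0` accounts for the exceptional weight `1 / 2` at `t = 0`.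
theorem vertWeight_mul_eq_sub (hq : q ≠ 0) {r t : ℤ} (hr : qSinh q r ≠ 0) (ht : 0 ≤ t) :
    vertWeight q (r * t) = (2 * qSinh q r)⁻¹ * (if t + 1 < 0 then 0 else qSinh q (r * (t + 1))) -
      (2 * qSinh q r)⁻¹ * if t - 1 < 0 then 0 else qSinh q (r * (t - 1)) := by
  have hr0 : r ≠ 0 := by
    rintro rfl
    exact hr (qSinh_zero q)
  rcases ht.eq_or_lt with rfl | ht
  · simp only [vertWeight, mul_zero, zero_add, zero_sub, mul_one]
    norm_num
    field_simp
  · rw [vertWeight, if_neg (mul_ne_zero hr0 ht.ne'), if_neg (by lia), if_neg (by lia), ← mul_sub,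
      mul_add, mul_sub r, mul_one, qSinh_add_sub_qSinh_sub hq]
    field_simp

theorem sum_interlacing_odd_strip (hq : q ≠ 0) (hfin : ¬ IsOfFinOrder q)
    {s : Fin m → ℤ} (hs : StrictMono s) (hodd : ∀ i, Odd (s i)) (hpos : ∀ i, 0 < s i) :
    ∑ t ∈ interlacing (Fin.cons (-1) s), (∏ i, vertWeight q (t i)) *
        (Matrix.vandermonde fun i => qCosh q (2 * t i)).det =
      (∏ k : Fin m, (2 * qSinh q (2 * k + 1))⁻¹) *
        ((∏ i, qSinh q (s i)) * (Matrix.vandermonde fun i => qCosh q (2 * s i)).det) := by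
  have hcons_odd (i : Fin (m + 1)) : Odd ((Fin.cons (-1) s : Fin (m + 1) → ℤ) i) := by
    refine Fin.cases ?_ (fun i => ?_) i
    · simp
    · simpa using hodd i
  have hcons_mono : Monotone (Fin.cons (-1) s : Fin (m + 1) → ℤ) :=
    (Fin.strictMono_cons.2 ⟨fun i => by linarith [hpos i], hs⟩).monotone
  simp only [prod_vertWeight_mul_det_vandermonde hq]
  rw [sum_interlacing_det hcons_mono (fun i => (hcons_odd _).sub_odd (hcons_odd _))
    (g := fun k t => vertWeight q ((2 * k + 1) * t))
    (G := fun k t => (2 * qSinh q (2 * k + 1))⁻¹ *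
      if t < 0 then 0 else qSinh q ((2 * k + 1) * t)) fun k i t ht => ?_,
    det_cons_one_of_zero _ (by simp), prod_qSinh_mul_det_vandermonde hq, ← Matrix.det_mul_row]
  · simp [(hpos _).not_gt]
  · refine vertWeight_mul_eq_sub hq (qSinh_ne_zero hq hfin (by lia)) ?_
    have hfirst := hcons_mono (Fin.zero_le i.castSucc)
    rw [Fin.cons_zero] at hfirst
    have := (mem_gap.1 ht).1.1
    lia

end WeylDenominators

section Region

/-- The part of the trapezoid above the line of height `j`, with the up-pointing triangles resting
on this line at the abscissas `s i` removed. -/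
def upperRegion (n x : ℕ) (j : ℤ) {m : ℕ} (s : Fin m → ℤ) : Finset UnitTriangle :=
  {t ∈ trapezoid n x | j ≤ t.2} \ univ.image fun i => (s i, j)

/-- The abscissas, from left to right, of some up-pointing triangles of the trapezoid that rest on
the line of height `j`. -/
structure IsDentSequence (n x : ℕ) (j : ℤ) {m : ℕ} (s : Fin m → ℤ) : Prop where
  strictMono : StrictMono s
  nonneg : ∀ i, 0 ≤ s i
  add_le : ∀ i, s i + j ≤ 2 * ((x : ℤ) + n) - 2
  even : ∀ i, Even (s i + j)

variable {n x m : ℕ} {j : ℤ}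

theorem mem_trapezoid {t : UnitTriangle} :
    t ∈ trapezoid n x ↔ (0 ≤ t.1 ∧ t.1 + t.2 ≤ 2 * ((x : ℤ) + n) - 2) ∧
      0 ≤ t.2 ∧ t.2 ≤ 2 * (n : ℤ) - 2 := by
  simp only [trapezoid, mem_filter, mem_product, mem_Icc]
  lia

theorem mem_upperRegion {s : Fin m → ℤ} {t : UnitTriangle} :
    t ∈ upperRegion n x j s ↔ (t ∈ trapezoid n x ∧ j ≤ t.2) ∧ ∀ i, (s i, j) ≠ t := by
  simp [upperRegion]

theorem upperRegion_eq_empty (hj : 2 * (n : ℤ) - 2 < j) (s : Fin m → ℤ) :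
    upperRegion n x j s = ∅ := by
  refine eq_empty_of_forall_notMem fun t ht => ?_
  rw [mem_upperRegion, mem_trapezoid] at ht
  lia

theorem upperRegion_cons_neg_one (s : Fin m → ℤ) :
    upperRegion n x j (Fin.cons (-1) s : Fin (m + 1) → ℤ) = upperRegion n x j s := by
  ext t
  simp only [mem_upperRegion, mem_trapezoid, Fin.forall_fin_succ, Fin.cons_zero, Fin.cons_succ]
  grind

theorem quarteredHexagon_eq_upperRegion (n x : ℕ) (s : ℕ → ℕ) :
    quarteredHexagon n x s = upperRegion n x 0 fun i : Fin n => 2 * (s (i + 1) : ℤ) - 2 := by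
  ext t
  simp only [quarteredHexagon, mem_upperRegion, mem_sdiff, mem_image, mem_Icc, baseTriangle,
    not_exists, not_and]
  constructor
  · rintro ⟨h1, h2⟩
    exact ⟨⟨h1, (mem_trapezoid.1 h1).2.1⟩, fun i => h2 (i + 1) ⟨by lia, by lia⟩⟩
  · rintro ⟨⟨h1, -⟩, h2⟩
    refine ⟨h1, fun i hi => ?_⟩
    have := h2 ⟨i - 1, by lia⟩
    rwa [show i - 1 + 1 = i from Nat.sub_add_cancel hi.1] at this

theorem isDentSequence_base {s : ℕ → ℕ} (hs : ∀ i ∈ Set.Icc 1 n, 1 ≤ s i ∧ s i ≤ n + x)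
    (hmono : StrictMonoOn s (Set.Icc 1 n)) :
    IsDentSequence n x 0 fun i : Fin n => 2 * (s (i + 1) : ℤ) - 2 where
  strictMono i k hik := by
    have : s (i + 1) < s (k + 1) :=
      hmono ⟨by lia, by lia⟩ ⟨by lia, by lia⟩ (Nat.succ_lt_succ hik)
    lia
  nonneg i := by
    have := (hs (i + 1) ⟨by lia, by lia⟩).1
    lia
  add_le i := by
    have := (hs (i + 1) ⟨by lia, by lia⟩).2
    lia
  even i := by simp [parity_simps]

theorem isDentSequence_of_mem_interlacing {s : Fin (m + 1) → ℤ} (hs : StrictMono s)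
    (hfirst : -1 ≤ s 0) (hlast : s (Fin.last m) + j ≤ 2 * ((x : ℤ) + n) - 2)
    (heven : ∀ i, Even (s i + j)) {t : Fin m → ℤ} (ht : t ∈ interlacing s) :
    IsDentSequence n x (j + 1) t := by
  have hgap (i) := mem_gap.1 (mem_interlacing.1 ht i)
  refine ⟨fun i k hik => ?_, fun i => ?_, fun i => ?_, fun i => ?_⟩
  · have := hs.monotone (Fin.succ_le_castSucc_iff.2 hik)
    linarith [(hgap i).1.2, (hgap k).1.1]
  · have := hs.monotone (Fin.zero_le i.castSucc)
    linarith [Int.add_one_le_iff.2 (hgap i).1.1]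
  · have := hs.monotone (Fin.le_last i.succ)
    linarith [Int.add_one_le_iff.2 (hgap i).1.2]
  · grind

end Region

section Evaluation

variable {K : Type*} [Field K] {q : K} {n x m : ℕ} {j : ℤ}

theorem wt₂_of_not_isVertical {l : TrianglePair} (hl : ¬ IsVertical l) : wt₂ q l = 1 := if_neg hl

theorem wt₂_vertical (q : K) (i j : ℤ) : wt₂ q ((i, j + 1), (i, j)) = vertWeight q i := by
  rw [wt₂, if_pos (by simp [IsVertical]), vertWeight, qCosh]

theorem tilingGF_upperRegion_eq_sum_interlacing (hj : 0 ≤ j) (hjm : j + m ≤ 2 * (n : ℤ) - 2)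
    {s : Fin (m + 1) → ℤ} (hs : StrictMono s) (heven : ∀ i, Even (s i + j))
    (hlast : s (Fin.last m) + j ≤ 2 * ((x : ℤ) + n) - 2)
    (hfirst : s 0 = -1 ∨ 0 ≤ s 0 ∧ Even j) :
    tilingGF (wt₂ q) (upperRegion n x j s) = ∑ t ∈ interlacing s,
      (∏ k, vertWeight q (t k)) * tilingGF (wt₂ q) (upperRegion n x (j + 1) t) := by
  obtain ⟨a, ha, has, hrow⟩ : ∃ a, Even (a + j) ∧ a ≤ s 0 ∧
      ∀ i ∉ Set.range s, 0 ≤ i ↔ a ≤ i := by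
    rcases hfirst with h | ⟨h, hj⟩
    · exact ⟨-1, h ▸ heven 0, h.ge, fun i hi => by grind⟩
    · exact ⟨0, by simpa, h, fun i _ => Iff.rfl⟩
  have hrange (i : ℤ) : i ∉ Set.range s ↔ ∀ k, (s k, j) ≠ (i, j) := by simp
  rw [tilingGF_eq_sum_interlacing (fun l => wt₂_of_not_isVertical)
    (fun t ht => (mem_upperRegion.1 ht).1.2) hs heven ha (b := 2 * ((x : ℤ) + n) - 2 - j)
    (by simp [parity_simps]) has (by linarith) (fun i => ?_) fun i h0 h1 _ => ?_]
  · refine sum_congr rfl fun t _ => ?_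
    simp only [wt₂_vertical]
    congr 2
    ext u
    simp only [mem_sdiff, mem_filter, mem_upperRegion, mem_image, mem_univ, true_and]
    grind
  · rw [mem_upperRegion, mem_trapezoid, ← hrange]
    refine and_congr_left fun hi => ?_
    rw [← hrow i hi]
    lia
  · rw [mem_upperRegion, mem_trapezoid]
    have : m ≠ 0 := by
      rintro rfl
      exact lt_asymm h0 h1
    simp only [ne_eq, Prod.mk.injEq, not_and]
    refine ⟨⟨⟨⟨?_, ?_⟩, ?_, ?_⟩, ?_⟩, fun k _ => ?_⟩ <;> lia

/-- The factor by which the two strips between a line with `k + 1` removed triangles and the second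
line above it, with `k` removed triangles, rescale the Vandermonde determinant. -/
def transferFactor (q : K) (k : ℕ) : K := ∏ r ∈ Icc 1 (2 * k), (2 * qSinh q r)⁻¹

theorem transferFactor_succ (q : K) (k : ℕ) :
    transferFactor q (k + 1) = transferFactor q k *
      ((2 * qSinh q (2 * k + 1))⁻¹ * (2 * qSinh q (2 * k + 2))⁻¹) := by
  rw [transferFactor, mul_add_one, prod_Icc_succ_top (by lia), prod_Icc_succ_top (by lia),
    ← transferFactor, mul_assoc]
  push_cast
  rfl

theorem transferFactor_eq_prod_odd_mul_prod_even (q : K) (k : ℕ) :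
    transferFactor q k = (∏ i : Fin k, (2 * qSinh q (2 * i + 1))⁻¹) *
      ∏ i : Fin k, (2 * qSinh q (2 * i + 2))⁻¹ := by
  induction k with
  | zero => simp [transferFactor]
  | succ k ih =>
    rw [transferFactor_succ, ih, Fin.prod_univ_castSucc, Fin.prod_univ_castSucc, mul_mul_mul_comm]
    rfl

theorem tilingGF_upperRegion_odd (hq : q ≠ 0) (hfin : ¬ IsOfFinOrder q) (hmn : m < n) {c : K}
    (hc : ∀ t : Fin m → ℤ, IsDentSequence n x (2 * (n - m)) t →
      tilingGF (wt₂ q) (upperRegion n x (2 * (n - m)) t) =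
        c * (Matrix.vandermonde fun i => qCosh q (2 * t i)).det)
    {s : Fin m → ℤ} (hs : IsDentSequence n x (2 * (n - m) - 1) s) :
    tilingGF (wt₂ q) (upperRegion n x (2 * (n - m) - 1) s) =
      c * ((∏ k : Fin m, (2 * qSinh q (2 * k + 1))⁻¹) *
        ((∏ i, qSinh q (s i)) * (Matrix.vandermonde fun i => qCosh q (2 * s i)).det)) := by
  rcases Nat.eq_zero_or_pos m with rfl | hm
  · have h := hc s ⟨hs.strictMono, finZeroElim, finZeroElim, finZeroElim⟩
    rw [upperRegion_eq_empty (by lia), tilingGF_empty] at h ⊢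
    simpa using h
  have hodd (i) : Odd (s i) := by have := hs.even i; grind
  have hpos (i) : 0 < s i := by have := hodd i; have := hs.nonneg i; grind
  have hcons : StrictMono (Fin.cons (-1) s : Fin (m + 1) → ℤ) :=
    Fin.strictMono_cons.2 ⟨fun i => by linarith [hpos i], hs.strictMono⟩
  have heven (i) : Even ((Fin.cons (-1) s : Fin (m + 1) → ℤ) i + (2 * (n - m) - 1)) := by
    refine Fin.cases ?_ hs.even i
    simp [parity_simps]
  have hlast : (Fin.cons (-1) s : Fin (m + 1) → ℤ) (Fin.last m) + (2 * (n - m) - 1) ≤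
      2 * ((x : ℤ) + n) - 2 := by
    obtain ⟨k, rfl⟩ := Nat.exists_eq_add_one.2 hm
    exact hs.add_le (Fin.last k)
  rw [← upperRegion_cons_neg_one, tilingGF_upperRegion_eq_sum_interlacing (by lia) (by lia) hcons
    heven hlast (.inl rfl), ← sum_interlacing_odd_strip hq hfin hs.strictMono hodd hpos, mul_sum]
  refine sum_congr rfl fun t ht => ?_
  have hdent := isDentSequence_of_mem_interlacing hcons (by rfl) hlast heven ht
  rw [sub_add_cancel] at hdent ⊢
  rw [hc t hdent, mul_left_comm]

theorem tilingGF_upperRegion_even_succ (hq : q ≠ 0) (hfin : ¬ IsOfFinOrder q) (hmn : m < n)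
    {c : K} (hc : ∀ t : Fin m → ℤ, IsDentSequence n x (2 * (n - m) - 1) t →
      tilingGF (wt₂ q) (upperRegion n x (2 * (n - m) - 1) t) =
        c * ((∏ i, qSinh q (t i)) * (Matrix.vandermonde fun i => qCosh q (2 * t i)).det))
    {s : Fin (m + 1) → ℤ} (hs : IsDentSequence n x (2 * (n - (m + 1))) s) :
    tilingGF (wt₂ q) (upperRegion n x (2 * (n - (m + 1))) s) =
      c * ((∏ k : Fin m, (2 * qSinh q (2 * k + 2))⁻¹) *
        (Matrix.vandermonde fun i => qCosh q (2 * s i)).det) := by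
  have heven (i) : Even (s i) := by have := hs.even i; grind
  have hheight : 2 * ((n : ℤ) - (m + 1)) + 1 = 2 * (n - m) - 1 := by ring
  rw [tilingGF_upperRegion_eq_sum_interlacing (by lia) (by lia) hs.strictMono hs.even
    (hs.add_le _) (.inr ⟨hs.nonneg 0, even_two_mul _⟩),
    ← sum_interlacing_even_strip hq hfin hs.strictMono.monotone heven, mul_sum]
  refine sum_congr rfl fun t ht => ?_
  have hdent := isDentSequence_of_mem_interlacing hs.strictMono
    (by linarith [hs.nonneg 0]) (hs.add_le _) hs.even ht
  rw [hheight] at hdent ⊢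
  rw [hc t hdent, mul_left_comm]

theorem tilingGF_upperRegion_even (hq : q ≠ 0) (hfin : ¬ IsOfFinOrder q) (hmn : m ≤ n)
    {s : Fin m → ℤ} (hs : IsDentSequence n x (2 * (n - m)) s) :
    tilingGF (wt₂ q) (upperRegion n x (2 * (n - m)) s) = (∏ k ∈ range m, transferFactor q k) *
      (Matrix.vandermonde fun i => qCosh q (2 * s i)).det := by
  induction m with
  | zero => simp [upperRegion_eq_empty, tilingGF_empty]
  | succ m ih =>
    push_cast at hs ⊢
    have hodd (t) (ht : IsDentSequence n x (2 * (n - m) - 1) t) :=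
      (tilingGF_upperRegion_odd hq hfin hmn (fun u hu => ih (by lia) hu) ht).trans
        (mul_assoc _ _ _).symm
    rw [tilingGF_upperRegion_even_succ hq hfin hmn hodd hs, prod_range_succ,
      transferFactor_eq_prod_odd_mul_prod_even]
    simp only [mul_assoc]

end Evaluation

section ProductFormula

variable {K : Type*} [Field K] {q : K}

theorem qInt_sq_mul_qSinh_one (hq : q ≠ 0) (m : ℕ) :
    qInt (q ^ 2) m * qSinh q 1 = q ^ ((m : ℤ) - 1) * qSinh q m := by
  have hgeom : qInt (q ^ 2) m * (q ^ 2 - 1) = (q ^ 2) ^ m - 1 := geom_sum_mul _ _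
  rw [qSinh, qSinh, zpow_sub₀ hq, zpow_neg, zpow_neg, zpow_natCast, zpow_one]
  field_simp
  linear_combination hgeom

theorem qFactorial_succ (p : K) (m : ℕ) :
    qFactorial p (m + 1) = qFactorial p m * qInt p (m + 1) :=
  prod_Icc_succ_top (by lia) _

theorem qFactorial_sq_mul_qSinh_one_pow (hq : q ≠ 0) (m : ℕ) :
    qFactorial (q ^ 2) m * qSinh q 1 ^ m = q ^ m.choose 2 * ∏ r ∈ Icc 1 m, qSinh q r := by
  induction m with
  | zero => simp [qFactorial]
  | succ m ih =>
    have hlast := qInt_sq_mul_qSinh_one hq (m + 1)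
    rw [Nat.cast_add_one, add_sub_cancel_right, zpow_natCast, ← Nat.cast_add_one] at hlast
    rw [qFactorial_succ, prod_Icc_succ_top (by lia), pow_succ (qSinh q 1),
      mul_mul_mul_comm, ih, hlast, Nat.choose_succ_succ' m 1, Nat.choose_one_right, pow_add]
    ring

theorem transferFactor_eq_div_qFactorial (hq : q ≠ 0) (k : ℕ) :
    transferFactor q k = 2 ^ (-(2 * k : ℤ)) * q ^ ((k : ℤ) * (2 * k - 1)) /
      (qFactorial (q ^ 2) (2 * k) * (qSinh q 1 ^ 2) ^ k) := by
  have hchoose : q ^ (2 * k).choose 2 = q ^ ((k : ℤ) * (2 * k - 1)) := by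
    rw [← zpow_natCast, Nat.choose_two_right, mul_assoc, Nat.mul_div_cancel_left _ two_pos]
    cases k <;> simp
  have hfactor : transferFactor q k = 2 ^ (-(2 * k : ℤ)) / ∏ r ∈ Icc 1 (2 * k), qSinh q r := by
    simp only [transferFactor, mul_inv, prod_mul_distrib, prod_const, Nat.card_Icc,
      prod_inv_distrib, zpow_neg]
    norm_cast
    simp [div_eq_mul_inv]
  rw [← pow_mul, qFactorial_sq_mul_qSinh_one_pow hq, hchoose, hfactor]
  field_simp

theorem qInt_sq_mul_qInt_sq (hq : q ≠ 0) {a b : ℕ} (ha : 1 ≤ a) (hab : a ≤ b) :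
    qInt (q ^ 2) (2 * (a + b - 2)) * qInt (q ^ 2) (2 * (b - a)) * qSinh q 1 ^ 2 =
      q ^ (4 * (b : ℤ) - 6) * (qCosh q (2 * (2 * b - 2)) - qCosh q (2 * (2 * a - 2))) := by
  have hsum := qInt_sq_mul_qSinh_one hq (2 * (a + b - 2))
  have hdiff := qInt_sq_mul_qSinh_one hq (2 * (b - a))
  have hcosh := qCosh_add_sub_qCosh_sub hq (2 * ((a : ℤ) + b - 2)) (2 * (b - a))
  rw [show ((2 * (a + b - 2) : ℕ) : ℤ) = 2 * ((a : ℤ) + b - 2) by lia] at hsum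
  rw [show ((2 * (b - a) : ℕ) : ℤ) = 2 * ((b : ℤ) - a) by lia] at hdiff
  rw [show 2 * ((a : ℤ) + b - 2) + 2 * (b - a) = 2 * (2 * b - 2) by ring,
    show 2 * ((a : ℤ) + b - 2) - 2 * (b - a) = 2 * (2 * a - 2) by ring] at hcosh
  rw [hcosh, sq (qSinh q 1), mul_mul_mul_comm, hsum, hdiff, mul_mul_mul_comm, ← zpow_add₀ hq]
  ring_nf

theorem transferFactor_mul_prod (hq : q ≠ 0) (hfin : ¬ IsOfFinOrder q) {s : ℕ → ℕ} {k : ℕ}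
    (hs : ∀ i ∈ Ico 1 (k + 1), 1 ≤ s i ∧ s i ≤ s (k + 1)) :
    transferFactor q k * ∏ i ∈ Ico 1 (k + 1),
        (qCosh q (2 * (2 * s (k + 1) - 2)) - qCosh q (2 * (2 * s i - 2))) =
      2 ^ (-(2 * k : ℤ)) *
        q ^ (-((4 * ((k + 1 : ℕ) : ℤ) - 4) * s (k + 1) - 2 * ((k + 1 : ℕ) : ℤ) ^ 2 -
          ((k + 1 : ℕ) : ℤ) + 3)) *
        ((∏ i ∈ Ico 1 (k + 1), qInt (q ^ 2) (2 * (s i + s (k + 1) - 2)) *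
          qInt (q ^ 2) (2 * (s (k + 1) - s i))) / qFactorial (q ^ 2) (2 * (k + 1) - 2)) := by
  set b := s (k + 1)
  have hS : qSinh q 1 ^ 2 ≠ 0 := pow_ne_zero 2 (qSinh_ne_zero hq hfin one_ne_zero)
  have hprod : ∏ i ∈ Ico 1 (k + 1), (qCosh q (2 * (2 * b - 2)) - qCosh q (2 * (2 * s i - 2))) =
      (∏ i ∈ Ico 1 (k + 1), qInt (q ^ 2) (2 * (s i + b - 2)) * qInt (q ^ 2) (2 * (b - s i))) *
        (q ^ (-((4 * (b : ℤ) - 6) * k)) * (qSinh q 1 ^ 2) ^ k) := by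
    have hconst : q ^ (-((4 * (b : ℤ) - 6) * k)) * (qSinh q 1 ^ 2) ^ k =
        ∏ _i ∈ Ico 1 (k + 1), q ^ (-(4 * (b : ℤ) - 6)) * qSinh q 1 ^ 2 := by
      rw [prod_const, Nat.card_Ico, add_tsub_cancel_right, mul_pow, ← zpow_natCast (q ^ _),
        ← zpow_mul, neg_mul]
    rw [hconst, ← prod_mul_distrib]
    refine prod_congr rfl fun i hi => ?_
    rw [mul_left_comm, qInt_sq_mul_qInt_sq hq (hs i hi).1 (hs i hi).2, ← mul_assoc, zpow_neg,
      inv_mul_cancel₀ (zpow_ne_zero _ hq), one_mul]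
  have hexp : q ^ (-((4 * ((k + 1 : ℕ) : ℤ) - 4) * b - 2 * ((k + 1 : ℕ) : ℤ) ^ 2 -
      ((k + 1 : ℕ) : ℤ) + 3)) = q ^ ((k : ℤ) * (2 * k - 1)) * q ^ (-((4 * (b : ℤ) - 6) * k)) := by
    rw [← zpow_add₀ hq]
    push_cast
    ring_nf
  rw [hprod, transferFactor_eq_div_qFactorial hq, hexp,
    show 2 * (k + 1) - 2 = 2 * k by lia]
  field_simp

theorem det_vandermonde_eq_prod_Icc {A : Type*} [CommRing A] (y : ℕ → A) (n : ℕ) :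
    (Matrix.vandermonde fun i : Fin n => y (i + 1)).det =
      ∏ j ∈ Icc 1 n, ∏ i ∈ Ico 1 j, (y j - y i) := by
  have hinner (j : Fin n) : ∏ i ∈ Iio j, (y (j + 1) - y (i + 1)) =
      ∏ i ∈ Ico 1 (j + 1 : ℕ), (y (j + 1) - y i) := by
    rw [prod_Ico_eq_prod_range, add_tsub_cancel_right, ← Nat.Iio_eq_range,
      ← Fin.map_valEmbedding_Iio, prod_map]
    simp only [Fin.valEmbedding_apply, add_comm]
  rw [Matrix.det_vandermonde, prod_comm' (t' := univ) (s' := fun j => Iio j) (by simp),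
    ← Ico_add_one_right_eq_Icc, prod_Ico_eq_prod_range, add_tsub_cancel_right,
    ← Fin.prod_univ_eq_prod_range (fun j => ∏ i ∈ Ico 1 (1 + j), (y (1 + j) - y i))]
  simp only [hinner, add_comm]

theorem tilingGFR3_eq_prod (hq : q ≠ 0) (hfin : ¬ IsOfFinOrder q) {n x : ℕ} {s : ℕ → ℕ}
    (hs : ∀ i ∈ Set.Icc 1 n, 1 ≤ s i ∧ s i ≤ n + x) (hmono : StrictMonoOn s (Set.Icc 1 n)) :
    tilingGFR3 q n x s = (∏ k ∈ range n, transferFactor q k) *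
      ∏ j ∈ Icc 1 n, ∏ i ∈ Ico 1 j,
        (qCosh q (2 * (2 * s j - 2)) - qCosh q (2 * (2 * s i - 2))) := by
  have hdents : IsDentSequence n x (2 * (n - n)) fun i : Fin n => 2 * (s (i + 1) : ℤ) - 2 := by
    simpa using isDentSequence_base hs hmono
  rw [← det_vandermonde_eq_prod_Icc (fun i => qCosh q (2 * (2 * s i - 2))),
    ← tilingGF_upperRegion_even hq hfin le_rfl hdents, tilingGFR3,
    quarteredHexagon_eq_upperRegion, sub_self, mul_zero]

theorem prod_transferFactor_mul_prod (hq : q ≠ 0) (h2 : (2 : K) ≠ 0) (hfin : ¬ IsOfFinOrder q)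
    {n : ℕ} {s : ℕ → ℕ} (hs : ∀ i ∈ Set.Icc 1 n, 1 ≤ s i) (hmono : MonotoneOn s (Set.Icc 1 n)) :
    (∏ k ∈ range n, transferFactor q k) *
        ∏ j ∈ Icc 1 n, ∏ i ∈ Ico 1 j,
          (qCosh q (2 * (2 * s j - 2)) - qCosh q (2 * (2 * s i - 2))) =
      2 ^ (-((n : ℤ) * (n - 1))) *
        q ^ (-∑ i ∈ Icc 1 n, ((4 * (i : ℤ) - 4) * s i - 2 * (i : ℤ) ^ 2 - i + 3)) *
        ((∏ j ∈ Icc 1 n, ∏ i ∈ Ico 1 j,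
            qInt (q ^ 2) (2 * (s i + s j - 2)) * qInt (q ^ 2) (2 * (s j - s i))) /
          ∏ i ∈ Icc 1 n, qFactorial (q ^ 2) (2 * i - 2)) := by
  induction n with
  | zero => simp
  | succ n ih =>
    have hsub : Set.Icc 1 n ⊆ Set.Icc 1 (n + 1) := Set.Icc_subset_Icc_right (by lia)
    have hlast := transferFactor_mul_prod hq hfin (k := n) fun i hi =>
      have hi := mem_Ico.1 hi
      ⟨hs i ⟨hi.1, hi.2.le⟩, hmono ⟨hi.1, hi.2.le⟩ ⟨by lia, le_rfl⟩ hi.2.le⟩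
    have htwo : (2 : K) ^ (-(((n + 1 : ℕ) : ℤ) * (((n + 1 : ℕ) : ℤ) - 1))) =
        2 ^ (-((n : ℤ) * (n - 1))) * 2 ^ (-(2 * n : ℤ)) := by
      rw [← zpow_add₀ h2]
      push_cast
      ring_nf
    rw [prod_range_succ, prod_Icc_succ_top (by lia), mul_mul_mul_comm,
      ih (fun i hi => hs i (hsub hi)) (hmono.mono hsub), hlast, prod_Icc_succ_top (by lia),
      prod_Icc_succ_top (by lia), sum_Icc_succ_top (by lia), neg_add (∑ i ∈ Icc 1 n, _),
      zpow_add₀ hq, htwo]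
    ring

theorem qFactorial_two_mul (p : K) (k : ℕ) :
    qFactorial p (2 * k) =
      ∏ i ∈ Ico 1 (k + 1), (qInt p (i + (k + 1) - 1) * qInt p (k + 1 - i)) := by
  have hlow : ∏ i ∈ Ico 1 (k + 1), qInt p (k + 1 - i) = ∏ i ∈ Ico 1 (k + 1), qInt p i := by
    rw [prod_Ico_reflect (fun i => qInt p i) 1 (by lia)]
    simp
  have hhigh : ∏ i ∈ Ico 1 (k + 1), qInt p (i + (k + 1) - 1) =
      ∏ i ∈ Ico (k + 1) (2 * k + 1), qInt p i := by
    rw [prod_Ico_eq_prod_range, prod_Ico_eq_prod_range]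
    exact prod_congr (by congr 1; lia) fun i _ => by congr 1; lia
  rw [prod_mul_distrib, hlow, hhigh, mul_comm (∏ i ∈ Ico (k + 1) _, _),
    prod_Ico_consecutive _ (by lia) (by lia), Ico_add_one_right_eq_Icc, qFactorial]

theorem prod_div_prod_qFactorial (p : K) (n : ℕ) (s : ℕ → ℕ) :
    (∏ j ∈ Icc 1 n, ∏ i ∈ Ico 1 j, qInt p (2 * (s i + s j - 2)) * qInt p (2 * (s j - s i))) /
        ∏ i ∈ Icc 1 n, qFactorial p (2 * i - 2) =
      (∏ j ∈ Icc 1 n, ∏ i ∈ Ico 1 j, qInt p (2 * (s i + s j - 2)) / qInt p (i + j - 1)) *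
        ∏ j ∈ Icc 1 n, ∏ i ∈ Ico 1 j, qInt p (2 * (s j - s i)) / qInt p (j - i) := by
  rw [← prod_div_distrib, ← prod_mul_distrib]
  refine prod_congr rfl fun j hj => ?_
  obtain ⟨k, rfl⟩ := Nat.exists_eq_add_one.2 (mem_Icc.1 hj).1
  rw [show 2 * (k + 1) - 2 = 2 * k by lia, qFactorial_two_mul, ← prod_div_distrib,
    ← prod_mul_distrib]
  exact prod_congr rfl fun i _ => (div_mul_div_comm _ _ _ _).symm

end ProductFormula

theorem not_isOfFinOrder_ratFunc_X {F : Type*} [Field F] :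
    ¬ IsOfFinOrder (RatFunc.X : RatFunc F) := by
  rw [isOfFinOrder_iff_pow_eq_one]
  rintro ⟨n, hn, hX⟩
  rw [← RatFunc.algebraMap_X, ← map_pow, ← map_one (algebraMap (Polynomial F) (RatFunc F))] at hX
  have hdeg := congrArg Polynomial.natDegree (RatFunc.algebraMap_injective F hX)
  rw [Polynomial.natDegree_X_pow, Polynomial.natDegree_one] at hdeg
  exact hn.ne' hdeg

end QuarteredHexagon

end

theorem mainTheorem5_general {K : Type*} [Field K] (n x : ℕ) (s : ℕ → ℕ)
    (hs : ∀ i ∈ Set.Icc 1 n, 1 ≤ s i ∧ s i ≤ n + x)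
    (hmono : StrictMonoOn s (Set.Icc 1 n))
    (q : K) (hq : q ≠ 0) (h2 : (2 : K) ≠ 0) (hfin : ¬ IsOfFinOrder q) :
    QuarteredHexagon.tilingGFR3 q n x s =
        (2 : K) ^ (-((n : ℤ) * ((n : ℤ) - 1))) *
          q ^ (-∑ i ∈ Finset.Icc 1 n,
            ((4 * (i : ℤ) - 4) * (s i : ℤ) - 2 * (i : ℤ) ^ 2 - (i : ℤ) + 3)) *
          ((∏ j ∈ Finset.Icc 1 n, ∏ i ∈ Finset.Ico 1 j,
              QuarteredHexagon.qInt (q ^ 2) (2 * (s i + s j - 2)) *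
                QuarteredHexagon.qInt (q ^ 2) (2 * (s j - s i))) /
            ∏ i ∈ Finset.Icc 1 n, QuarteredHexagon.qFactorial (q ^ 2) (2 * i - 2)) ∧
      QuarteredHexagon.tilingGFR3 q n x s =
        (2 : K) ^ (-((n : ℤ) * ((n : ℤ) - 1))) *
          q ^ (-∑ i ∈ Finset.Icc 1 n,
            ((4 * (i : ℤ) - 4) * (s i : ℤ) - 2 * (i : ℤ) ^ 2 - (i : ℤ) + 3)) *
          (∏ j ∈ Finset.Icc 1 n, ∏ i ∈ Finset.Ico 1 j,
            QuarteredHexagon.qInt (q ^ 2) (2 * (s i + s j - 2)) /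
              QuarteredHexagon.qInt (q ^ 2) (i + j - 1)) *
          (∏ j ∈ Finset.Icc 1 n, ∏ i ∈ Finset.Ico 1 j,
            QuarteredHexagon.qInt (q ^ 2) (2 * (s j - s i)) /
              QuarteredHexagon.qInt (q ^ 2) (j - i)) := by
  have hM := QuarteredHexagon.tilingGFR3_eq_prod hq hfin hs hmono
  rw [QuarteredHexagon.prod_transferFactor_mul_prod hq h2 hfin (fun i hi => (hs i hi).1)
    hmono.monotoneOn] at hM
  refine ⟨hM, ?_⟩
  rw [mul_assoc _ (∏ j ∈ Icc 1 n, _), ← QuarteredHexagon.prod_div_prod_qFactorial]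
  exact hM

theorem mainTheorem5 (n x : ℕ) (s : ℕ → ℕ)
    (hs : ∀ i ∈ Set.Icc 1 n, 1 ≤ s i ∧ s i ≤ n + x)
    (hmono : StrictMonoOn s (Set.Icc 1 n))
    (q : RatFunc ℚ) (hq : q = RatFunc.X) :
    QuarteredHexagon.tilingGFR3 q n x s =
        (2 : RatFunc ℚ) ^ (-((n : ℤ) * ((n : ℤ) - 1))) *
          q ^ (-∑ i ∈ Finset.Icc 1 n,
            ((4 * (i : ℤ) - 4) * (s i : ℤ) - 2 * (i : ℤ) ^ 2 - (i : ℤ) + 3)) *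
          ((∏ j ∈ Finset.Icc 1 n, ∏ i ∈ Finset.Ico 1 j,
              QuarteredHexagon.qInt (q ^ 2) (2 * (s i + s j - 2)) *
                QuarteredHexagon.qInt (q ^ 2) (2 * (s j - s i))) /
            ∏ i ∈ Finset.Icc 1 n, QuarteredHexagon.qFactorial (q ^ 2) (2 * i - 2)) ∧
      QuarteredHexagon.tilingGFR3 q n x s =
        (2 : RatFunc ℚ) ^ (-((n : ℤ) * ((n : ℤ) - 1))) *
          q ^ (-∑ i ∈ Finset.Icc 1 n,
            ((4 * (i : ℤ) - 4) * (s i : ℤ) - 2 * (i : ℤ) ^ 2 - (i : ℤ) + 3)) *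
          (∏ j ∈ Finset.Icc 1 n, ∏ i ∈ Finset.Ico 1 j,
            QuarteredHexagon.qInt (q ^ 2) (2 * (s i + s j - 2)) /
              QuarteredHexagon.qInt (q ^ 2) (i + j - 1)) *
          (∏ j ∈ Finset.Icc 1 n, ∏ i ∈ Finset.Ico 1 j,
            QuarteredHexagon.qInt (q ^ 2) (2 * (s j - s i)) /
              QuarteredHexagon.qInt (q ^ 2) (j - i)) := by
  subst hq
  exact mainTheorem5_general n x s hs hmono RatFunc.X RatFunc.X_ne_zero two_ne_zero
    QuarteredHexagon.not_isOfFinOrder_ratFunc_X
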